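/- Let $N\ge 2$ bidders have values in $[0,1]$, each with the same known marginal distribution $F$, an arbitrary Borel probability measure on $[0,1]$. Let $\Pi(F)$ be the set of joint distributions on $[0,1]^N$ all of whose $N$ marginals are $F$. A direct mechanism consists of Borel maps $q,t:[0,1]^N\to\mathbb R^N$ with $q_i\ge 0$ and $\sum_i q_i\le 1$. It is DSIC if $v_iq_i(v)-t_i(v)\ge v_iq_i(v_i',v_{-i})-t_i(v_i',v_{-i})$ for all $i,v,v_i'$; EPIR if $v_iq_i(v)-t_i(v)\ge 0$ for all $i,v$; and exclusive if $q_i(v)=0$ whenever $v_i<\max_j v_j$. A maxmin auction among exclusive DSIC and EPIR mechanisms is a mechanism $(q,t)$ in this class that maximizes, over the class, the worst-case expected revenue $\inf_{\pi\in\Pi(F)}\int\sum_i t_i(v)\,d\pi(v)\in[-\infty,\infty)$. The Second Price Auction with $\mathrm{Beta}(\frac1{N-1},1)$ distributed reserves is the following mechanism. Let $v_{(1)}$ be the highest bid and $v_{(2)}$ the second highest bid. If exactly one bidder $i$ bids $v_{(1)}$, then $q_i(v)=v_{(1)}^{\frac1{N-1}}$ and $t_i(v)=\frac1N v_{(1)}^{\frac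 N{N-1}}+\frac{N-1}N v_{(2)}^{\frac N{N-1}}$. If exactly $K\ge 2$ bidders bid $v_{(1)}$, then $q_i(v)=\frac1K v_{(1)}^{\frac1{N-1}}$ and $t_i(v)=\frac1K v_{(1)}^{\frac N{N-1}}$ for each of them. All other bidders get and pay $0$. If the Second Price Auction with $\mathrm{Beta}(\frac1{N-1},1)$ distributed reserves is a maxmin auction among exclusive DSIC and EPIR mechanisms for $F$, then the general robust-version regularity conditions (I) hold almost surely; that is, $$f(x)\ \ge\ \frac{x^{-1-\frac N{N-1}}}{N-1}\int_{(0,x)}s^{\frac N{N-1}}\,dF(s)\quad\text{for Lebesgue-almost every }x\in(0,1),$$ $$F(\{1\})\ \ge\ \frac1{N-1}\int_{(0,1)}s^{\frac N{N-1}}\,dF(s),$$ where $f(x)$ is the derivative at $x$ of the cumulative distribution function of $F$, which exists for Lebesgue-almost every $x$. (If $F$ has density $f$ on $(0,1)$, then $dF(s)=f(s)\,ds$ in these integrals.) -/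

import Mathlib

open MeasureTheory

namespace RobustAuction

/-- Profiles of values (or bids) of `N` bidders, each in the unit interval. -/
abbrev Profile (N : ℕ) : Type := Fin N → unitInterval

/-- A direct mechanism: an allocation rule `alloc` (with `alloc v i` the probability that bidder `i`
gets the good at the profile `v`) and a payment rule `pay`. -/
structure Mechanism (N : ℕ) where
  alloc : Profile N → Fin N → ℝ
  pay : Profile N → Fin N → ℝ

namespace Mechanism

variable {N : ℕ}

/-- The allocation probabilities are nonnegative and sum to at most one, and both rules are Borel
measurable, so that expected revenue makes sense. -/
structure IsFeasible (M : Mechanism N) : Prop where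
  alloc_nonneg : ∀ v i, 0 ≤ M.alloc v i
  sum_alloc_le_one : ∀ v, ∑ i, M.alloc v i ≤ 1
  measurable_alloc : Measurable M.alloc
  measurable_pay : Measurable M.pay

/-- Ex-post individual rationality: truthful bidders never end up with negative utility. -/
def IsEPIR (M : Mechanism N) : Prop :=
  ∀ v i, 0 ≤ (v i : ℝ) * M.alloc v i - M.pay v i

/-- Dominant strategy incentive compatibility: no bidder `i` gains by bidding some `x` instead of
the true value `v i`, whatever the bids of the others. -/
def IsDSIC (M : Mechanism N) : Prop :=
  ∀ (v : Profile N) (i : Fin N) (x : unitInterval),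
    (v i : ℝ) * M.alloc (Function.update v i x) i - M.pay (Function.update v i x) i ≤
      (v i : ℝ) * M.alloc v i - M.pay v i

/-- Exclusivity: a bidder whose value is not the highest one gets nothing. -/
def IsExclusive (M : Mechanism N) : Prop :=
  ∀ (v : Profile N) (i : Fin N), (∃ j, v i < v j) → M.alloc v i = 0

/-- Expected revenue when the value profile has distribution `π`, as an extended real number. For a
feasible EPIR mechanism the total payment is at most `1`, so only the second integral can be
infinite, and then the expected revenue is `-∞`. -/
noncomputable def revenue (M : Mechanism N) (π : Measure (Profile N)) : EReal :=
  ((∫⁻ v, ENNReal.ofReal (∑ i, M.pay v i) ∂π : ENNReal) : EReal) -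
    ((∫⁻ v, ENNReal.ofReal (-∑ i, M.pay v i) ∂π : ENNReal) : EReal)

end Mechanism

/-- The exclusive DSIC and EPIR mechanisms with `N` bidders. -/
def exclusiveMechanisms (N : ℕ) : Set (Mechanism N) :=
  {M | M.IsFeasible ∧ M.IsDSIC ∧ M.IsEPIR ∧ M.IsExclusive}

/-- The joint distributions of `N` values all of whose marginals are `F`. -/
def couplings (N : ℕ) (F : Measure unitInterval) : Set (Measure (Profile N)) :=
  {π | IsProbabilityMeasure π ∧ ∀ i, π.map (fun v => v i) = F}

/-- The worst-case expected revenue over all joint distributions with marginals `F`. -/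
noncomputable def Mechanism.guarantee {N : ℕ} (M : Mechanism N) (F : Measure unitInterval) :
    EReal :=
  ⨅ π ∈ couplings N F, M.revenue π

/-- `M` is a maxmin auction among the mechanisms in `L`, for the marginal `F`. -/
def IsMaxmin {N : ℕ} (L : Set (Mechanism N)) (F : Measure unitInterval) (M : Mechanism N) : Prop :=
  M ∈ L ∧ ∀ M' ∈ L, M'.guarantee F ≤ M.guarantee F

/-- The highest bid. -/
def highest {N : ℕ} (v : Profile N) : unitInterval := Finset.univ.sup v

/-- The bidders whose bid is the highest one. -/
noncomputable def winners {N : ℕ} (v : Profile N) : Finset (Fin N) :=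
  Finset.univ.filter (fun i => v i = highest v)

/-- The highest bid among the bidders other than `i`. If `i` is the only highest bidder, this is the
second highest bid. -/
def highestOther {N : ℕ} (v : Profile N) (i : Fin N) : unitInterval := (Finset.univ.erase i).sup v

/-- The second price auction with `Beta(1/(N-1), 1)`-distributed reserve, ties broken uniformly. -/
noncomputable def betaReserveAuction (N : ℕ) : Mechanism N where
  alloc v i :=
    if i ∈ winners v then
      (highest v : ℝ) ^ ((1 : ℝ) / ((N : ℝ) - 1)) / ((winners v).card : ℝ)
    else 0
  pay v i :=
    if i ∈ winners v then
      if (winners v).card = 1 then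
        1 / (N : ℝ) * (highest v : ℝ) ^ ((N : ℝ) / ((N : ℝ) - 1)) +
          ((N : ℝ) - 1) / (N : ℝ) * (highestOther v i : ℝ) ^ ((N : ℝ) / ((N : ℝ) - 1))
      else
        1 / ((winners v).card : ℝ) * (highest v : ℝ) ^ ((N : ℝ) / ((N : ℝ) - 1))
    else 0

/-- The distribution `F` on the unit interval, seen as a distribution on the real line. -/
noncomputable def onLine (F : Measure unitInterval) : Measure ℝ :=
  F.map (fun x : unitInterval => (x : ℝ))

/-- The density of `F`: the derivative of its cumulative distribution function (which exists at
Lebesgue-almost every point). -/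
noncomputable def density (F : Measure unitInterval) (x : ℝ) : ℝ :=
  deriv (fun y => ProbabilityTheory.cdf (onLine F) y) x

/-- The general robust-version regularity conditions (I), the first one at Lebesgue-almost every
point of `(0, 1)`. The integrals are with respect to `F` itself, so that possible atoms of `F` inside
`(0, 1)` are counted; if `F` has density `f` on `(0, 1)`, then `dF(s) = f(s) ds` there. -/
structure RegularityI (N : ℕ) (F : Measure unitInterval) : Prop where
  density_ge : ∀ᵐ x ∂(volume.restrict (Set.Ioo (0 : ℝ) 1)),
    x ^ (-1 - (N : ℝ) / ((N : ℝ) - 1)) / ((N : ℝ) - 1) *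
      ∫ s in Set.Ioo 0 x, s ^ ((N : ℝ) / ((N : ℝ) - 1)) ∂(onLine F) ≤ density F x
  mass_ge : 1 / ((N : ℝ) - 1) *
      ∫ s in Set.Ioo (0 : ℝ) 1, s ^ ((N : ℝ) / ((N : ℝ) - 1)) ∂(onLine F) ≤ F.real {1}

end RobustAuction

namespace RobustAuction

/-! Put p = N/(N-1). A reserve distribution H that is a subgradient of a convex B yields an
exclusive DSIC and EPIR auction; the beta reserve auction is the case H(y) = y^(p-1), B(y) = y^p/p.
When (N-1)(yH - B) ≤ B, total payment dominates the separable function ∑ (v_i H(v_i) - B(v_i)),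
whose expectation depends only on the marginals, so the guarantee is at least N ∫ (yH - B) dF
(`IsReserveRule.le_guarantee`). Conversely, identical values hold the beta auction down to ∫ y^p dF
(`guarantee_betaReserveAuction_le`). Hence, if the beta auction is maxmin, no admissible pair (H, B)
can make N ∫ (yH - B) dF exceed ∫ y^p dF, and every perturbation of y^(p-1) gives an inequality on
F.

Two perturbations suffice. Scaling y^(p-1) up by a^(1-p) below a and capping it at 1 gains on (0, a)
and loses on (a, 1]; letting a increase to 1 gives the bound on the atom
(`mul_setIntegral_rpow_le_measureReal_Ioc`). Scaling by D ≥ 1 below a, keeping H constant up to c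
and then returning to y^(p-1) gains (D-1) ∫ s^p dF over (0, a) and loses at most p c^(p-1) ∫ (s-a)
dF over (a, c] (`taylor_mul_setIntegral_rpow_le`). Both sides are of second order in c - a;
comparing them as c decreases to a, where the distribution function is differentiable, gives the
bound on the density (`density_ge_of_hasDerivAt`). -/

/-- `H` is the distribution function of a random reserve price and `B` a convex function vanishing
at `0` of which `H` is a subgradient. -/
structure IsReserveRule (H B : unitInterval → ℝ) : Prop where
  nonneg : ∀ x, 0 ≤ H x
  le_one : ∀ x, H x ≤ 1
  zero : B 0 = 0
  subgradient : ∀ x z : unitInterval, B z + H z * ((x : ℝ) - z) ≤ B x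

/-! ### Consequences of convexity for a reserve rule. -/

namespace IsReserveRule

variable {H B : unitInterval → ℝ}

lemma monotone_right (h : IsReserveRule H B) : Monotone B := fun z x hzx => by
  have h1 := h.subgradient x z
  have h2 : (0 : ℝ) ≤ (x : ℝ) - z := sub_nonneg.2 hzx
  nlinarith [mul_nonneg (h.nonneg z) h2]

lemma monotone_left (h : IsReserveRule H B) : Monotone H := fun z x hzx => by
  rcases hzx.eq_or_lt with rfl | hlt
  · exact le_rfl
  have h1 := h.subgradient x z
  have h2 := h.subgradient z x
  have h3 : (0 : ℝ) < (x : ℝ) - z := sub_pos.2 hlt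
  by_contra hc
  nlinarith

/-- This is the Legendre transform of B at the slope H x; it grows with the slope because values are
nonnegative. Monotonicity also supplies measurability for free. -/
lemma monotone_conjugate (h : IsReserveRule H B) :
    Monotone fun x : unitInterval => (x : ℝ) * H x - B x := fun z x hzx => by
  have h1 := h.subgradient z x
  have h2 := h.monotone_left hzx
  have h3 : (0 : ℝ) ≤ z := z.2.1
  simp only
  nlinarith

lemma conjugate_nonneg (h : IsReserveRule H B) (x : unitInterval) : 0 ≤ (x : ℝ) * H x - B x := by
  have h1 := h.subgradient 0 x
  simp only [h.zero, Set.Icc.coe_zero] at h1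
  linarith

end IsReserveRule

/-- The second price auction with a random reserve price of distribution function `H`, for a
primitive `B` of `H`, ties broken uniformly. -/
noncomputable def reserveAuction (N : ℕ) (H B : unitInterval → ℝ) : Mechanism N where
  alloc v i := if i ∈ winners v then H (highest v) / ((winners v).card : ℝ) else 0
  pay v i :=
    if i ∈ winners v then
      ((highest v : ℝ) * H (highest v) - B (highest v) + B (highestOther v i)) /
        ((winners v).card : ℝ)
    else 0

/-! ### Highest bids and winners. -/

section Winners

variable {N : ℕ}

lemma mem_winners {v : Profile N} {i : Fin N} : i ∈ winners v ↔ v i = highest v := by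
  simp [winners]

lemma le_highest (v : Profile N) (i : Fin N) : v i ≤ highest v :=
  Finset.le_sup (f := v) (Finset.mem_univ i)

lemma le_highestOther (v : Profile N) {i j : Fin N} (hji : j ≠ i) : v j ≤ highestOther v i :=
  Finset.le_sup (f := v) (Finset.mem_erase.2 ⟨hji, Finset.mem_univ j⟩)

lemma highest_eq_sup (v : Profile N) (i : Fin N) : highest v = v i ⊔ highestOther v i := by
  rw [highest, highestOther, ← Finset.sup_insert, Finset.insert_erase (Finset.mem_univ i)]

lemma mem_winners_iff {v : Profile N} {i : Fin N} : i ∈ winners v ↔ highestOther v i ≤ v i := by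
  rw [mem_winners, highest_eq_sup v i, eq_comm, sup_eq_left]

lemma winners_nonempty (hN : 0 < N) (v : Profile N) : (winners v).Nonempty := by
  have : Nonempty (Fin N) := ⟨⟨0, hN⟩⟩
  obtain ⟨i, -, hi⟩ := Finset.exists_mem_eq_sup Finset.univ Finset.univ_nonempty v
  exact ⟨i, mem_winners.2 hi.symm⟩

lemma highestOther_update (v : Profile N) (i : Fin N) (x : unitInterval) :
    highestOther (Function.update v i x) i = highestOther v i := by
  refine Finset.sup_congr rfl fun j hj => ?_
  rw [Function.update_of_ne (Finset.ne_of_mem_erase hj)]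

lemma card_winners_eq_one {v : Profile N} {i : Fin N} (hi : highestOther v i < v i) :
    (winners v).card = 1 := by
  rw [Finset.card_eq_one]
  refine ⟨i, Finset.eq_singleton_iff_unique_mem.2 ⟨mem_winners_iff.2 hi.le, fun j hj => ?_⟩⟩
  by_contra hji
  have h1 := le_highestOther v hji
  have h2 := le_highest v i
  rw [← mem_winners.1 hj] at h2
  exact absurd (h2.trans h1) (not_le.2 hi)

lemma measurable_highest : Measurable (highest : Profile N → unitInterval) := by
  have : Continuous (highest : Profile N → unitInterval) := by
    unfold highest
    exact Continuous.finset_sup_apply fun i _ => continuous_apply i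
  exact this.measurable

lemma measurable_highestOther (i : Fin N) :
    Measurable fun v : Profile N => highestOther v i := by
  have : Continuous fun v : Profile N => highestOther v i := by
    unfold highestOther
    exact Continuous.finset_sup_apply fun i _ => continuous_apply i
  exact this.measurable

lemma measurableSet_mem_winners (i : Fin N) : MeasurableSet {v : Profile N | i ∈ winners v} := by
  simp only [mem_winners]
  exact measurableSet_eq_fun (measurable_pi_apply i) measurable_highest

lemma measurable_card_winners : Measurable fun v : Profile N => ((winners v).card : ℝ) := by
  have : (fun v : Profile N => ((winners v).card : ℝ)) =
      fun v => ∑ i, if i ∈ winners v then (1 : ℝ) else 0 := by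
    funext v
    rw [Finset.sum_ite_mem]
    simp
  rw [this]
  exact Finset.measurable_sum _ fun i _ =>
    Measurable.ite (measurableSet_mem_winners i) measurable_const measurable_const

end Winners

/-! ### Incentives and guaranteed revenue of random reserves. -/

section ReserveAuction

variable {N : ℕ} {H B : unitInterval → ℝ}

lemma IsReserveRule.isFeasible (h : IsReserveRule H B) :
    (reserveAuction N H B).IsFeasible where
  alloc_nonneg v i := by
    simp only [reserveAuction]
    split_ifs
    · exact div_nonneg (h.nonneg _) (Nat.cast_nonneg _)
    · exact le_rfl
  sum_alloc_le_one v := by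
    simp only [reserveAuction]
    rw [Finset.sum_ite_mem, Finset.univ_inter, Finset.sum_const, nsmul_eq_mul]
    rcases Nat.eq_zero_or_pos (winners v).card with h0 | h0
    · simp [h0]
    · rw [mul_div_cancel₀ _ (by positivity)]
      exact h.le_one _
  measurable_alloc := measurable_pi_lambda _ fun i =>
    Measurable.ite (measurableSet_mem_winners i)
      ((h.monotone_left.measurable.comp measurable_highest).div measurable_card_winners)
      measurable_const
  measurable_pay := measurable_pi_lambda _ fun i =>
    Measurable.ite (measurableSet_mem_winners i)
      (((h.monotone_conjugate.measurable.comp measurable_highest).add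
        (h.monotone_right.measurable.comp (measurable_highestOther i))).div
          measurable_card_winners)
      measurable_const

/-- Envelope formula. In a tie both sides vanish, so dividing by the number of winners does no harm.
-/
lemma IsReserveRule.truthful_utility (h : IsReserveRule H B) (v : Profile N) (i : Fin N) :
    (v i : ℝ) * (reserveAuction N H B).alloc v i - (reserveAuction N H B).pay v i =
      max 0 (B (v i) - B (highestOther v i)) := by
  simp only [reserveAuction]
  by_cases hi : i ∈ winners v
  · have hv := mem_winners.1 hi
    have hle := mem_winners_iff.1 hi
    rw [if_pos hi, if_pos hi, ← hv, max_eq_right (sub_nonneg.2 (h.monotone_right hle))]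
    rcases hle.eq_or_lt with heq | hlt
    · rw [heq]; ring
    · rw [card_winners_eq_one hlt]; push_cast; ring
  · have hle := (not_le.1 (mt mem_winners_iff.2 hi)).le
    rw [if_neg hi, if_neg hi, max_eq_left (sub_nonpos.2 (h.monotone_right hle))]
    simp

/-- For a winning bid z this is the subgradient inequality at z; sharing with tied winners costs
nothing because truthful utility is nonnegative. -/
lemma IsReserveRule.isDSIC (h : IsReserveRule H B) : (reserveAuction N H B).IsDSIC := by
  intro v i z
  rw [h.truthful_utility]
  simp only [reserveAuction]
  set w := Function.update v i z with hw
  by_cases hi : i ∈ winners w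
  · have hv : z = highest w := by rw [← mem_winners.1 hi, hw, Function.update_self]
    rw [if_pos hi, if_pos hi, ← hv, hw, highestOther_update, ← hw]
    have hc : (1 : ℝ) ≤ ((winners w).card : ℝ) := by
      exact_mod_cast Finset.card_pos.2 ⟨i, hi⟩
    have hs := h.subgradient (v i) z
    have hm := le_max_right 0 (B (v i) - B (highestOther v i))
    have h0 := le_max_left 0 (B (v i) - B (highestOther v i))
    rw [mul_div_assoc', ← sub_div, div_le_iff₀ (by linarith)]
    nlinarith
  · rw [if_neg hi, if_neg hi]
    simp

lemma IsReserveRule.isEPIR (h : IsReserveRule H B) : (reserveAuction N H B).IsEPIR := by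
  intro v i
  rw [h.truthful_utility]
  exact le_max_left _ _

lemma isExclusive_reserveAuction : (reserveAuction N H B).IsExclusive := by
  rintro v i ⟨j, hj⟩
  simp only [reserveAuction]
  rw [if_neg]
  intro hi
  exact absurd (le_highest v j) (not_le.2 (mem_winners.1 hi ▸ hj))

lemma IsReserveRule.mem_exclusiveMechanisms (h : IsReserveRule H B) :
    reserveAuction N H B ∈ exclusiveMechanisms N :=
  ⟨h.isFeasible, h.isDSIC, h.isEPIR, isExclusive_reserveAuction⟩

/-- The dual certificate. The winner's own term appears in the price; the other N-1 terms are each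
at most the conjugate at the highest other bid, and `hB` bounds their total by the remaining part B
of the price. -/
lemma IsReserveRule.sum_conjugate_le_sum_pay (hN : 0 < N) (h : IsReserveRule H B)
    (hB : ∀ y : unitInterval, ((N : ℝ) - 1) * ((y : ℝ) * H y - B y) ≤ B y) (v : Profile N) :
    ∑ i, ((v i : ℝ) * H (v i) - B (v i)) ≤ ∑ i, (reserveAuction N H B).pay v i := by
  have hpos : (0 : ℝ) < ((winners v).card : ℝ) := by
    exact_mod_cast (winners_nonempty hN v).card_pos
  have key : ∀ i ∈ winners v, (∑ j, ((v j : ℝ) * H (v j) - B (v j))) / ((winners v).card : ℝ) ≤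
      (reserveAuction N H B).pay v i := by
    intro i hi
    simp only [reserveAuction]
    rw [if_pos hi]
    refine div_le_div_of_nonneg_right ?_ hpos.le
    rw [← Finset.add_sum_erase _ _ (Finset.mem_univ i), mem_winners.1 hi]
    refine add_le_add le_rfl ((Finset.sum_le_card_nsmul _ _ _ fun j hj =>
      h.monotone_conjugate (le_highestOther v (Finset.ne_of_mem_erase hj))).trans ?_)
    rw [Finset.card_erase_of_mem (Finset.mem_univ i), Finset.card_univ, Fintype.card_fin,
      nsmul_eq_mul, Nat.cast_sub hN, Nat.cast_one]
    exact hB _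
  have h1 := Finset.card_nsmul_le_sum _ _ _ key
  rw [nsmul_eq_mul, mul_div_cancel₀ _ hpos.ne'] at h1
  refine h1.trans_eq ?_
  refine Finset.sum_subset (Finset.subset_univ _) fun i _ hi => ?_
  simp only [reserveAuction]
  rw [if_neg hi]

lemma IsReserveRule.le_guarantee (hN : 0 < N) (h : IsReserveRule H B)
    (hB : ∀ y : unitInterval, ((N : ℝ) - 1) * ((y : ℝ) * H y - B y) ≤ B y)
    (F : Measure unitInterval) :
    ((N * ∫⁻ y, ENNReal.ofReal ((y : ℝ) * H y - B y) ∂F : ENNReal) : EReal) ≤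
      (reserveAuction N H B).guarantee F := by
  refine le_iInf₂ fun π hπ => ?_
  have hle := h.sum_conjugate_le_sum_pay hN hB
  have hnn : ∀ v : Profile N, 0 ≤ ∑ i, ((v i : ℝ) * H (v i) - B (v i)) := fun v =>
    Finset.sum_nonneg fun i _ => h.conjugate_nonneg _
  have h0 : ∫⁻ v, ENNReal.ofReal (-∑ i, (reserveAuction N H B).pay v i) ∂π = 0 := by
    rw [← lintegral_zero (μ := π)]
    refine lintegral_congr fun v => ENNReal.ofReal_of_nonpos ?_
    linarith [hle v, hnn v]
  rw [Mechanism.revenue, h0, EReal.coe_ennreal_zero, sub_zero, EReal.coe_ennreal_le_coe_ennreal_iff]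
  have hmeas : Measurable fun y : unitInterval => ENNReal.ofReal ((y : ℝ) * H y - B y) :=
    h.monotone_conjugate.measurable.ennreal_ofReal
  calc (N : ENNReal) * ∫⁻ y, ENNReal.ofReal ((y : ℝ) * H y - B y) ∂F
      = ∑ i : Fin N, ∫⁻ v, ENNReal.ofReal ((v i : ℝ) * H (v i) - B (v i)) ∂π := by
        rw [Finset.sum_congr rfl fun i _ => (?_ : _ =
          ∫⁻ y, ENNReal.ofReal ((y : ℝ) * H y - B y) ∂F)]
        · simp
        · rw [← hπ.2 i, lintegral_map hmeas (measurable_pi_apply i)]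
    _ = ∫⁻ v, ∑ i : Fin N, ENNReal.ofReal ((v i : ℝ) * H (v i) - B (v i)) ∂π :=
        (lintegral_finsetSum _ fun i _ => hmeas.comp (measurable_pi_apply i)).symm
    _ = ∫⁻ v, ENNReal.ofReal (∑ i : Fin N, ((v i : ℝ) * H (v i) - B (v i))) ∂π :=
        lintegral_congr fun v =>
          (ENNReal.ofReal_sum_of_nonneg fun i _ => h.conjugate_nonneg _).symm
    _ ≤ _ := lintegral_mono fun v => ENNReal.ofReal_le_ofReal (hle v)

end ReserveAuction

/-! ### Comonotone values against the beta reserve auction. -/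

lemma sum_pay_betaReserveAuction_const {N : ℕ} (hN : 2 ≤ N) (x : unitInterval) :
    ∑ i, (betaReserveAuction N).pay (fun _ => x) i = (x : ℝ) ^ ((N : ℝ) / ((N : ℝ) - 1)) := by
  have : Nonempty (Fin N) := ⟨⟨0, by omega⟩⟩
  have hh : highest (fun _ : Fin N => x) = x := Finset.sup_const Finset.univ_nonempty x
  have hw : winners (fun _ : Fin N => x) = Finset.univ := by
    ext i
    simp [mem_winners, hh]
  have hN0 : (N : ℝ) ≠ 0 := by positivity
  simp only [betaReserveAuction, hw, hh, Finset.mem_univ, if_true, Finset.card_univ,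
    Fintype.card_fin]
  have hN1 : N ≠ 1 := by omega
  simp only [if_neg hN1]
  rw [Finset.sum_const, Finset.card_univ, Fintype.card_fin, nsmul_eq_mul]
  field_simp

/-- Test against the diagonal coupling, where all bidders tie. -/
lemma guarantee_betaReserveAuction_le {N : ℕ} (hN : 2 ≤ N) (F : Measure unitInterval)
    [IsProbabilityMeasure F] :
    (betaReserveAuction N).guarantee F ≤
      ((∫⁻ y, ENNReal.ofReal ((y : ℝ) ^ ((N : ℝ) / ((N : ℝ) - 1))) ∂F : ENNReal) : EReal) := by
  have hm : MeasurableEmbedding fun (x : unitInterval) (_ : Fin N) => x := by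
    have : Nonempty (Fin N) := ⟨⟨0, by omega⟩⟩
    refine Continuous.measurableEmbedding (by fun_prop) fun x y hxy => ?_
    exact congrFun hxy (Classical.arbitrary _)
  have hmem : F.map (fun x (_ : Fin N) => x) ∈ couplings N F := by
    refine ⟨Measure.isProbabilityMeasure_map hm.measurable.aemeasurable, fun i => ?_⟩
    rw [Measure.map_map (measurable_pi_apply i) hm.measurable]
    exact Measure.map_id
  refine (iInf₂_le _ hmem).trans ?_
  have h0 : ∫⁻ v, ENNReal.ofReal (-∑ i, (betaReserveAuction N).pay v i)
      ∂(F.map fun x (_ : Fin N) => x) = 0 := by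
    rw [hm.lintegral_map, ← lintegral_zero (μ := F)]
    refine lintegral_congr fun x => ENNReal.ofReal_of_nonpos ?_
    rw [sum_pay_betaReserveAuction_const hN]
    exact neg_nonpos.2 (Real.rpow_nonneg x.2.1 _)
  rw [Mechanism.revenue, h0, EReal.coe_ennreal_zero, sub_zero, hm.lintegral_map]
  simp only [sum_pay_betaReserveAuction_const hN]
  exact le_rfl

/-- If the beta reserve auction is maxmin, no other reserve rule has a better revenue guarantee. -/
lemma IsReserveRule.integral_conjugate_le {N : ℕ} (hN : 2 ≤ N) {F : Measure unitInterval}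
    [IsProbabilityMeasure F] (hF : IsMaxmin (exclusiveMechanisms N) F (betaReserveAuction N))
    {H B : unitInterval → ℝ} (h : IsReserveRule H B)
    (hB : ∀ y : unitInterval, ((N : ℝ) - 1) * ((y : ℝ) * H y - B y) ≤ B y) :
    ∫ y, N * ((y : ℝ) * H y - B y) ∂F ≤ ∫ y, (y : ℝ) ^ ((N : ℝ) / ((N : ℝ) - 1)) ∂F := by
  have h1 := (h.le_guarantee (by omega) hB F).trans
    ((hF.2 _ h.mem_exclusiveMechanisms).trans (guarantee_betaReserveAuction_le hN F))
  rw [EReal.coe_ennreal_le_coe_ennreal_iff] at h1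
  have hN' : (2 : ℝ) ≤ N := by exact_mod_cast hN
  have hmeas : Measurable fun y : unitInterval => (y : ℝ) ^ ((N : ℝ) / ((N : ℝ) - 1)) := by
    fun_prop
  have hle1 : ∀ y : unitInterval, (y : ℝ) ^ ((N : ℝ) / ((N : ℝ) - 1)) ≤ 1 := fun y =>
    Real.rpow_le_one y.2.1 y.2.2 (div_nonneg (by linarith) (by linarith))
  rw [integral_eq_lintegral_of_nonneg_ae
      (.of_forall fun y => mul_nonneg (Nat.cast_nonneg N) (h.conjugate_nonneg y))
      (h.monotone_conjugate.measurable.const_mul _).aestronglyMeasurable,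
    integral_eq_lintegral_of_nonneg_ae (.of_forall fun y => Real.rpow_nonneg y.2.1 _)
      hmeas.aestronglyMeasurable]
  refine ENNReal.toReal_mono ?_ ?_
  · refine ne_top_of_le_ne_top ENNReal.one_ne_top
      ((lintegral_mono (g := fun _ => 1) fun y => ?_).trans (by simp))
    exact ENNReal.ofReal_le_one.2 (hle1 y)
  · refine le_trans (le_of_eq ?_) h1
    rw [← lintegral_const_mul _ h.monotone_conjugate.measurable.ennreal_ofReal]
    refine lintegral_congr fun y => ?_
    rw [ENNReal.ofReal_mul (Nat.cast_nonneg N), ENNReal.ofReal_natCast]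

/-! ### Convexity estimates for powers. -/

section PowerInequalities

variable {p : ℝ}

lemma rpow_div_add_rpow_mul_sub_le (hp : 1 < p) {x z : ℝ} (hx : 0 ≤ x) (hz : 0 ≤ z) :
    z ^ p / p + z ^ (p - 1) * (x - z) ≤ x ^ p / p := by
  have hp0 : 0 < p := by linarith
  rcases hz.eq_or_lt with rfl | hz
  · rw [Real.zero_rpow hp0.ne', Real.zero_rpow (by linarith)]
    have := Real.rpow_nonneg hx p
    simp only [zero_div, zero_mul, add_zero]
    positivity
  · have h1 := one_add_mul_self_le_rpow_one_add (s := x / z - 1)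
      (by linarith [div_nonneg hx hz.le]) hp.le
    rw [add_sub_cancel, Real.div_rpow hx hz.le, le_div_iff₀ (by positivity)] at h1
    rw [Real.rpow_sub_one hz.ne']
    have h2 : (1 + p * (x / z - 1)) * z ^ p = p * (z ^ p / p + z ^ p / z * (x - z)) := by
      field_simp
    rw [h2] at h1
    rw [le_div_iff₀ hp0]
    linarith

lemma sub_mul_rpow_le (hp : 1 ≤ p) {a y c : ℝ} (ha : 0 ≤ a) (hay : a ≤ y) (hyc : y ≤ c) :
    (c - a) * y ^ p ≤ (c - y) * a ^ p + (y - a) * c ^ p := by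
  rcases (hay.trans hyc).eq_or_lt with hac | hac
  · have h1 : y = a := le_antisymm (by linarith) hay
    subst h1
    rw [hac]
    linarith
  · have hca : 0 < c - a := by linarith
    have h := (convexOn_rpow hp).2 (Set.mem_Ici.2 ha) (Set.mem_Ici.2 (ha.trans hac.le))
      (show 0 ≤ (c - y) / (c - a) from div_nonneg (by linarith) hca.le)
      (show 0 ≤ (y - a) / (c - a) from div_nonneg (by linarith) hca.le) (by field_simp; ring)
    simp only [smul_eq_mul] at h
    have h2 : (c - y) / (c - a) * a + (y - a) / (c - a) * c = y := by field_simp; ring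
    rw [h2] at h
    calc (c - a) * y ^ p ≤ (c - a) * ((c - y) / (c - a) * a ^ p + (y - a) / (c - a) * c ^ p) :=
          mul_le_mul_of_nonneg_left h hca.le
      _ = _ := by field_simp

/-- For p ≤ 2 the second derivative p(p-1)y^(p-2) is smallest on [a, c] at c. The derivative of the
difference is shown nonnegative by Bernoulli's inequality with exponent p-1 in [0, 1], applied to
a/y. -/
lemma rpow_taylor_two_le (hp : 1 < p) (hp2 : p ≤ 2) {a c : ℝ} (ha : 0 < a) (hac : a ≤ c) :
    a ^ p + p * a ^ (p - 1) * (c - a) + p * (p - 1) / 2 * c ^ (p - 2) * (c - a) ^ 2 ≤ c ^ p := by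
  have hd : ∀ y ∈ Set.Icc a c, HasDerivAt (fun y : ℝ => y ^ p - p * a ^ (p - 1) * (y - a) -
      p * (p - 1) / 2 * c ^ (p - 2) * (y - a) ^ 2)
      (p * y ^ (p - 1) - p * a ^ (p - 1) - p * (p - 1) * c ^ (p - 2) * (y - a)) y := by
    intro y hy
    have h0 : y ≠ 0 := (ha.trans_le hy.1).ne'
    have h1 := (((Real.hasDerivAt_rpow_const (p := p) (.inl h0)).sub
      (((hasDerivAt_id y).sub_const a).const_mul (p * a ^ (p - 1)))).sub
      ((((hasDerivAt_id y).sub_const a).pow 2).const_mul (p * (p - 1) / 2 * c ^ (p - 2))))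
    refine (h1.congr_deriv ?_)
    simp only [id_eq, Nat.cast_ofNat, Nat.add_one_sub_one, pow_one]
    ring
  have hmono := monotoneOn_of_deriv_nonneg (convex_Icc a c)
    (fun y hy => (hd y hy).continuousAt.continuousWithinAt)
    (fun y hy => (hd y (interior_subset hy)).differentiableAt.differentiableWithinAt) (by
      intro y hy
      have hy' := interior_subset hy
      rw [(hd y hy').deriv]
      have hy0 : 0 < y := ha.trans_le hy'.1
      have h1 := rpow_one_add_le_one_add_mul_self (s := a / y - 1)
        (by linarith [div_nonneg ha.le hy0.le]) (p := p - 1) (by linarith) (by linarith)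
      rw [add_sub_cancel, Real.div_rpow ha.le hy0.le, div_le_iff₀ (by positivity)] at h1
      have h2 : y ^ (p - 2) = y ^ (p - 1) / y := by
        rw [← Real.rpow_sub_one hy0.ne']; ring_nf
      have h3 : c ^ (p - 2) ≤ y ^ (p - 2) :=
        Real.rpow_le_rpow_of_nonpos hy0 hy'.2 (by linarith)
      have h4 : (1 + (p - 1) * (a / y - 1)) * y ^ (p - 1) =
          y ^ (p - 1) - (p - 1) * y ^ (p - 2) * (y - a) := by
        rw [h2]; field_simp; ring
      have h5 : (p - 1) * c ^ (p - 2) * (y - a) ≤ (p - 1) * y ^ (p - 2) * (y - a) := by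
        have : 0 ≤ y - a := by linarith [hy'.1]
        have : 0 ≤ p - 1 := by linarith
        gcongr
      nlinarith)
  have := hmono (Set.left_mem_Icc.2 hac) (Set.right_mem_Icc.2 hac) hac
  simp only [sub_self, mul_zero] at this
  linarith

end PowerInequalities

/-! ### Capped power rules and their gluing. -/

section TruncatedPower

/-- The convex function equal to `y ^ p / p` on `[0, a]`, continued affinely with the same slope
beyond `a`. -/
noncomputable def truncatedPower (p a y : ℝ) : ℝ :=
  min y a ^ p / p + a ^ (p - 1) * (y - min y a)

variable {p a D : ℝ}

lemma truncatedPower_of_le {y : ℝ} (h : y ≤ a) : truncatedPower p a y = y ^ p / p := by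
  simp [truncatedPower, min_eq_left h]

lemma truncatedPower_of_ge {y : ℝ} (h : a ≤ y) :
    truncatedPower p a y = a ^ p / p + a ^ (p - 1) * (y - a) := by
  simp [truncatedPower, min_eq_right h]

lemma truncatedPower_subgradient (hp : 1 < p) (ha : 0 ≤ a) {x z : ℝ} (hx : 0 ≤ x) (hz : 0 ≤ z) :
    truncatedPower p a z + min z a ^ (p - 1) * (x - z) ≤ truncatedPower p a x := by
  rcases le_total x a with hxa | hxa <;> rcases le_total z a with hza | hza
  · rw [truncatedPower_of_le hxa, truncatedPower_of_le hza, min_eq_left hza]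
    exact rpow_div_add_rpow_mul_sub_le hp hx hz
  · rw [truncatedPower_of_le hxa, truncatedPower_of_ge hza, min_eq_right hza]
    have := rpow_div_add_rpow_mul_sub_le hp hx ha
    linarith
  · rw [truncatedPower_of_ge hxa, truncatedPower_of_le hza, min_eq_left hza]
    have h1 := rpow_div_add_rpow_mul_sub_le hp ha hz
    have h2 : z ^ (p - 1) ≤ a ^ (p - 1) := Real.rpow_le_rpow hz hza (by linarith)
    nlinarith
  · rw [truncatedPower_of_ge hxa, truncatedPower_of_ge hza, min_eq_right hza]
    linarith

/-- A Legendre transform is constant along an affine piece, so only `min y a` matters. -/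
lemma truncatedPower_conjugate (hp : 1 < p) (ha : 0 < a) {y : ℝ} (hy : 0 ≤ y) :
    y * min y a ^ (p - 1) - truncatedPower p a y = (1 - 1 / p) * min y a ^ p := by
  rcases le_total y a with h | h
  · rw [truncatedPower_of_le h, min_eq_left h]
    have : y * y ^ (p - 1) = y ^ p := by
      rcases hy.eq_or_lt with rfl | hy
      · rw [zero_mul, Real.zero_rpow (by linarith)]
      · rw [Real.rpow_sub_one hy.ne']; field_simp
    rw [this]; ring
  · rw [truncatedPower_of_ge h, min_eq_right h, Real.rpow_sub_one ha.ne']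
    field_simp
    ring

lemma rpow_div_le_truncatedPower (ha : 0 ≤ a) (y : ℝ) :
    min y a ^ p / p ≤ truncatedPower p a y := by
  rw [truncatedPower, le_add_iff_nonneg_right]
  exact mul_nonneg (Real.rpow_nonneg ha _) (sub_nonneg.2 (min_le_left _ _))

lemma isReserveRule_truncatedPower (hp : 1 < p) (ha : 0 < a) (hD : 0 ≤ D)
    (hDa : D * a ^ (p - 1) ≤ 1) :
    IsReserveRule (fun y => D * min (y : ℝ) a ^ (p - 1)) (fun y => D * truncatedPower p a y) where
  nonneg y := mul_nonneg hD (Real.rpow_nonneg (le_min y.2.1 ha.le) _)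
  le_one y := le_trans (mul_le_mul_of_nonneg_left
    (Real.rpow_le_rpow (le_min y.2.1 ha.le) (min_le_right _ _) (by linarith)) hD) hDa
  zero := by
    rw [Set.Icc.coe_zero, truncatedPower_of_le ha.le, Real.zero_rpow (by linarith)]
    simp
  subgradient x z := by
    have := mul_le_mul_of_nonneg_left (truncatedPower_subgradient hp ha.le x.2.1 z.2.1) hD
    linarith

/-- Switching from one reserve rule to another one where their primitives cross. -/
lemma IsReserveRule.ite {H₁ B₁ H₂ B₂ : unitInterval → ℝ} (h₁ : IsReserveRule H₁ B₁)
    (h₂ : IsReserveRule H₂ B₂) {s : unitInterval → Prop} [DecidablePred s]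
    (hs : ∀ y, s y → B₂ y ≤ B₁ y) (hs' : ∀ y, ¬ s y → B₁ y ≤ B₂ y) :
    IsReserveRule (fun y => if s y then H₁ y else H₂ y) (fun y => if s y then B₁ y else B₂ y) where
  nonneg y := by
    split_ifs
    exacts [h₁.nonneg y, h₂.nonneg y]
  le_one y := by
    split_ifs
    exacts [h₁.le_one y, h₂.le_one y]
  zero := by
    split_ifs
    exacts [h₁.zero, h₂.zero]
  subgradient x z := by
    have hx₁ : B₁ x ≤ if s x then B₁ x else B₂ x := by
      split_ifs with h
      exacts [le_rfl, hs' x h]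
    have hx₂ : B₂ x ≤ if s x then B₁ x else B₂ x := by
      split_ifs with h
      exacts [hs x h, le_rfl]
    by_cases hz : s z
    · simp only [if_pos hz]
      exact (h₁.subgradient x z).trans hx₁
    · simp only [if_neg hz]
      exact (h₂.subgradient x z).trans hx₂

end TruncatedPower

/-! ### Perturbation inequalities. -/

section Optimality

variable {N : ℕ} {F : Measure unitInterval} [IsProbabilityMeasure F] {p : ℝ}

instance isProbabilityMeasure_onLine : IsProbabilityMeasure (onLine F) :=
  Measure.isProbabilityMeasure_map measurable_subtype_coe.aemeasurable

omit [IsProbabilityMeasure F] in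
lemma integral_onLine (g : ℝ → ℝ) : ∫ y, g y ∂(onLine F) = ∫ y : unitInterval, g y ∂F :=
  (MeasurableEmbedding.subtype_coe measurableSet_Icc).integral_map g

/-- Here g is any integrable minorant of the pointwise gain over y^p, which lets the perturbations
be estimated by simple indicator expressions. -/
lemma IsReserveRule.integral_nonpos (hN : 2 ≤ N)
    (hF : IsMaxmin (exclusiveMechanisms N) F (betaReserveAuction N))
    {H B : unitInterval → ℝ} (h : IsReserveRule H B)
    (hB : ∀ y : unitInterval, ((N : ℝ) - 1) * ((y : ℝ) * H y - B y) ≤ B y) {g : ℝ → ℝ}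
    (hg : Integrable g (onLine F))
    (hle : ∀ y : unitInterval,
      g y + (y : ℝ) ^ ((N : ℝ) / ((N : ℝ) - 1)) ≤ N * ((y : ℝ) * H y - B y)) :
    ∫ y, g y ∂(onLine F) ≤ 0 := by
  have h1 := h.integral_conjugate_le hN hF hB
  have hN' : (2 : ℝ) ≤ N := by exact_mod_cast hN
  have hgF : Integrable (fun y : unitInterval => g y) F :=
    ((MeasurableEmbedding.subtype_coe measurableSet_Icc).integrable_map_iff).1 hg
  have hint : Integrable (fun y : unitInterval => (y : ℝ) ^ ((N : ℝ) / ((N : ℝ) - 1))) F := by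
    refine Integrable.of_bound (C := 1) (Measurable.aestronglyMeasurable (by fun_prop)) (.of_forall fun y => ?_)
    rw [Real.norm_of_nonneg (Real.rpow_nonneg y.2.1 _)]
    exact Real.rpow_le_one y.2.1 y.2.2 (div_nonneg (by linarith) (by linarith))
  have hint' : Integrable (fun y : unitInterval => N * ((y : ℝ) * H y - B y)) F := by
    refine Integrable.of_bound (C := N * ((1 : unitInterval) * H 1 - B 1))
      (h.monotone_conjugate.measurable.const_mul _).aestronglyMeasurable (.of_forall fun y => ?_)
    rw [Real.norm_of_nonneg (mul_nonneg (Nat.cast_nonneg N) (h.conjugate_nonneg y))]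
    exact mul_le_mul_of_nonneg_left (h.monotone_conjugate le_top) (Nat.cast_nonneg N)
  have h2 := integral_mono (hgF.add hint) hint' hle
  simp only [Pi.add_apply] at h2
  rw [integral_add hgF hint] at h2
  rw [integral_onLine]
  linarith

/-- Since (N-1)(1-1/p) = 1/p, there is equality below a; beyond a the left side is frozen while the
right side does not decrease. -/
lemma conjugate_truncatedPower_le (hN : 2 ≤ N) {a D : ℝ} (ha : 0 < a) (hD : 0 ≤ D)
    (hp : p = (N : ℝ) / ((N : ℝ) - 1)) {y : ℝ} (hy : 0 ≤ y) :
    ((N : ℝ) - 1) * (y * (D * min y a ^ (p - 1)) - D * truncatedPower p a y) ≤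
      D * truncatedPower p a y := by
  have hN' : (2 : ℝ) ≤ N := by exact_mod_cast hN
  have hN1 : (0 : ℝ) < N - 1 := by linarith
  have hp1 : 1 < p := by rw [hp, lt_div_iff₀ hN1]; linarith
  have h1 := truncatedPower_conjugate hp1 ha hy
  have h2 := mul_le_mul_of_nonneg_left (rpow_div_le_truncatedPower (p := p) ha.le y) hD
  have h3 : ((N : ℝ) - 1) * (1 - 1 / p) = 1 / p := by rw [hp]; field_simp; ring
  calc _ = D * (((N : ℝ) - 1) * (y * min y a ^ (p - 1) - truncatedPower p a y)) := by ring
    _ = D * (min y a ^ p / p) := by rw [h1, ← mul_assoc _ _ (min y a ^ p), h3]; ring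
    _ ≤ _ := h2

lemma mul_conjugate_truncatedPower (hN : 2 ≤ N) {a D : ℝ} (ha : 0 < a)
    (hp : p = (N : ℝ) / ((N : ℝ) - 1)) {y : ℝ} (hy : 0 ≤ y) :
    N * (y * (D * min y a ^ (p - 1)) - D * truncatedPower p a y) = D * min y a ^ p := by
  have hN' : (2 : ℝ) ≤ N := by exact_mod_cast hN
  have hN1 : (0 : ℝ) < N - 1 := by linarith
  have hp1 : 1 < p := by rw [hp, lt_div_iff₀ hN1]; linarith
  have h1 := truncatedPower_conjugate hp1 ha hy
  have h3 : (N : ℝ) * (1 - 1 / p) = 1 := by rw [hp]; field_simp; ring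
  calc _ = D * (N * (y * min y a ^ (p - 1) - truncatedPower p a y)) := by ring
    _ = _ := by rw [h1, ← mul_assoc _ _ (min y a ^ p), h3, one_mul]

lemma integrable_indicator_rpow (hp : 0 ≤ p) {a : ℝ} (ha : a ≤ 1) :
    Integrable (Set.indicator (Set.Ioo 0 a) fun y : ℝ => y ^ p) (onLine F) := by
  refine (integrable_indicator_iff measurableSet_Ioo).2
    (Measure.integrableOn_of_bounded (M := 1) (measure_ne_top _ _)
      (Measurable.aestronglyMeasurable (by fun_prop)) ?_)
  filter_upwards [ae_restrict_mem measurableSet_Ioo] with y hy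
  rw [Real.norm_of_nonneg (Real.rpow_nonneg hy.1.le _)]
  exact Real.rpow_le_one hy.1.le (hy.2.le.trans ha) hp

lemma integrableOn_sub (μ : Measure ℝ) [IsFiniteMeasure μ] (a c : ℝ) :
    IntegrableOn (fun y : ℝ => y - a) (Set.Ioc a c) μ := by
  refine Measure.integrableOn_of_bounded (M := c - a) (measure_ne_top _ _)
    (Measurable.aestronglyMeasurable (by fun_prop)) ?_
  filter_upwards [ae_restrict_mem measurableSet_Ioc] with y hy
  rw [Real.norm_of_nonneg (by linarith [hy.1])]
  linarith [hy.2]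

lemma mul_setIntegral_rpow_le_measureReal_Ioc (hN : 2 ≤ N)
    (hF : IsMaxmin (exclusiveMechanisms N) F (betaReserveAuction N))
    (hp : p = (N : ℝ) / ((N : ℝ) - 1)) {a : ℝ} (ha : 0 < a) (ha1 : a < 1) :
    (p - 1) * ∫ s in Set.Ioo 0 a, s ^ p ∂(onLine F) ≤ (onLine F).real (Set.Ioc a 1) := by
  have hN' : (2 : ℝ) ≤ N := by exact_mod_cast hN
  have hN1 : (0 : ℝ) < N - 1 := by linarith
  have hp1 : 1 < p := by rw [hp, lt_div_iff₀ hN1]; linarith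
  have hD : 0 ≤ a ^ (1 - p) := Real.rpow_nonneg ha.le _
  have hDa : a ^ (1 - p) * a ^ (p - 1) = 1 := by rw [← Real.rpow_add ha]; simp
  have hDa' : a ^ (1 - p) * a ^ p = a := by rw [← Real.rpow_add ha]; simp
  -- Linearizing D - 1 makes 1 - a a common factor of gain and loss, to be cancelled at the end.
  have hD1 : (p - 1) * (1 - a) ≤ a ^ (1 - p) - 1 := by
    rw [Real.rpow_def_of_pos ha]
    have h1 := Real.add_one_le_exp (Real.log a * (1 - p))
    have h2 := Real.log_le_sub_one_of_pos ha
    nlinarith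
  have hint := integrable_indicator_rpow (F := F) (zero_le_one.trans hp1.le) ha1.le
  have hint' : Integrable (Set.indicator (Set.Ioc a 1) fun _ : ℝ => (1 : ℝ)) (onLine F) :=
    (integrable_const _).indicator measurableSet_Ioc
  have key := (isReserveRule_truncatedPower hp1 ha hD hDa.le).integral_nonpos hN hF
    (fun y => conjugate_truncatedPower_le hN ha hD hp y.2.1)
    (g := fun y => (1 - a) * ((p - 1) * Set.indicator (Set.Ioo 0 a) (fun y : ℝ => y ^ p) y -
      Set.indicator (Set.Ioc a 1) (fun _ : ℝ => (1 : ℝ)) y))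
    (((hint.const_mul _).sub hint').const_mul _) (fun y => by
      rw [mul_conjugate_truncatedPower hN ha hp y.2.1, ← hp]
      have hy0 : (0 : ℝ) ≤ y := y.2.1
      have hyp : (0 : ℝ) ≤ (y : ℝ) ^ p := Real.rpow_nonneg hy0 p
      rcases le_or_gt (y : ℝ) a with hya | hya
      · rw [min_eq_left hya, Set.indicator_of_notMem (s := Set.Ioc a 1) (by simp [hya])]
        have : Set.indicator (Set.Ioo 0 a) (fun y : ℝ => y ^ p) y ≤ (y : ℝ) ^ p :=
          Set.indicator_le_self' (fun _ _ => hyp) _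
        have h1 := mul_le_mul_of_nonneg_left this (by nlinarith : 0 ≤ (p - 1) * (1 - a))
        nlinarith
      · rw [min_eq_right hya.le, hDa', Set.indicator_of_mem (s := Set.Ioc a 1) ⟨hya, y.2.2⟩,
          Set.indicator_of_notMem (s := Set.Ioo 0 a) (by simp [hya.le])]
        have := Real.rpow_le_one hy0 y.2.2 (zero_le_one.trans hp1.le)
        linarith)
  rw [integral_const_mul, integral_sub (hint.const_mul _) hint', integral_const_mul,
    integral_indicator measurableSet_Ioo, integral_indicator measurableSet_Ioc,
    setIntegral_const, smul_eq_mul, mul_one] at key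
  have := nonpos_of_mul_nonpos_right key (by linarith)
  linarith

lemma taylor_mul_setIntegral_rpow_le (hN : 2 ≤ N)
    (hF : IsMaxmin (exclusiveMechanisms N) F (betaReserveAuction N))
    (hp : p = (N : ℝ) / ((N : ℝ) - 1)) {a c : ℝ} (ha : 0 < a) (hac : a < c) (hc : c ≤ 1) :
    (c ^ p / (a ^ p + p * a ^ (p - 1) * (c - a)) - 1) * ∫ s in Set.Ioo 0 a, s ^ p ∂(onLine F) ≤
      p * c ^ (p - 1) * ∫ s in Set.Ioc a c, (s - a) ∂(onLine F) := by
  have hN' : (2 : ℝ) ≤ N := by exact_mod_cast hN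
  have hN1 : (0 : ℝ) < N - 1 := by linarith
  have hp1 : 1 < p := by rw [hp, lt_div_iff₀ hN1]; linarith
  have hp0 : 0 < p := by linarith
  have hc0 : 0 < c := ha.trans hac
  have hE : 0 < a ^ p + p * a ^ (p - 1) * (c - a) := by
    have : 0 < c - a := by linarith
    positivity
  set E := a ^ p + p * a ^ (p - 1) * (c - a) with hEdef
  -- This D makes the scaled truncated primitive meet y^p/p exactly at c.
  set D := c ^ p / E with hDdef
  have hDE : D * E = c ^ p := div_mul_cancel₀ _ hE.ne'
  have hEc : E ≤ c ^ p := by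
    have := rpow_div_add_rpow_mul_sub_le hp1 hc0.le ha.le
    rw [← mul_le_mul_iff_right₀ hp0] at this
    rw [mul_div_cancel₀ _ hp0.ne', mul_add, mul_div_cancel₀ _ hp0.ne'] at this
    linarith
  have hD1 : 1 ≤ D := (one_le_div hE).2 hEc
  have hD : 0 ≤ D := by linarith
  -- The cap stays a probability because c^p ≤ c ≤ a + p(c - a).
  have hDa : D * a ^ (p - 1) ≤ 1 := by
    rw [hDdef, div_mul_eq_mul_div, div_le_one hE, hEdef]
    have h1 : a ^ p = a ^ (p - 1) * a := by rw [Real.rpow_sub_one ha.ne']; field_simp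
    have h2 : c ^ p ≤ c := by
      simpa using Real.rpow_le_rpow_of_exponent_ge hc0 hc hp1.le
    have h3 : 0 < a ^ (p - 1) := by positivity
    rw [h1]
    nlinarith [mul_le_mul_of_nonneg_right h2 h3.le, mul_nonneg h3.le (sub_nonneg.2 hac.le)]
  have hone : IsReserveRule (fun y => 1 * min (y : ℝ) 1 ^ (p - 1))
    (fun y => 1 * truncatedPower p 1 y) :=
    isReserveRule_truncatedPower hp1 one_pos zero_le_one (by simp)
  have hap : 0 < a ^ p := by positivity
  -- The glued primitive is the larger of the two. On [a, c] the first one is affine, starts at or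
  -- above y^p/p and meets it at c; convexity of y^p puts it above before c and below after.
  have hrule := (isReserveRule_truncatedPower hp1 ha hD hDa).ite hone
    (s := fun y => (y : ℝ) < c) (fun y hy => by
      rw [truncatedPower_of_le y.2.2, one_mul]
      rcases le_total (y : ℝ) a with hya | hya
      · rw [truncatedPower_of_le hya]
        exact le_mul_of_one_le_left (div_nonneg (Real.rpow_nonneg y.2.1 _) hp0.le) hD1
      · rw [truncatedPower_of_ge hya, div_le_iff₀ hp0]
        have h1 := sub_mul_rpow_le hp1.le ha.le hya hy.le
        have h2 : (c - y) * a ^ p ≤ (c - y) * (D * a ^ p) :=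
          mul_le_mul_of_nonneg_left (le_mul_of_one_le_left hap.le hD1) (by linarith)
        have h3 : (c - a) * (D * (a ^ p / p + a ^ (p - 1) * (y - a)) * p) =
            (c - y) * (D * a ^ p) + (y - a) * c ^ p := by
          rw [← hDE, hEdef]; field_simp; ring
        refine le_of_mul_le_mul_left ?_ (sub_pos.2 hac)
        linarith) (fun y hy => by
      have hcy := not_lt.1 hy
      rw [truncatedPower_of_le y.2.2, one_mul, truncatedPower_of_ge (hac.le.trans hcy),
        le_div_iff₀ hp0]
      have h1 := sub_mul_rpow_le hp1.le ha.le hac.le hcy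
      have h2 : (y - c) * a ^ p ≤ (y - c) * (D * a ^ p) :=
        mul_le_mul_of_nonneg_left (le_mul_of_one_le_left hap.le hD1) (by linarith)
      have h3 : (c - a) * (D * (a ^ p / p + a ^ (p - 1) * (y - a)) * p) =
          (y - a) * c ^ p - (y - c) * (D * a ^ p) := by
        rw [← hDE, hEdef]; field_simp; ring
      refine le_of_mul_le_mul_left ?_ (sub_pos.2 hac)
      linarith)
  have hint := integrable_indicator_rpow (F := F) hp0.le (hac.le.trans hc)
  have hint' := (integrable_indicator_iff measurableSet_Ioc).2 (integrableOn_sub (onLine F) a c)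
  have key := hrule.integral_nonpos hN hF
    (fun y => by
      split_ifs
      · exact conjugate_truncatedPower_le hN ha hD hp y.2.1
      · exact conjugate_truncatedPower_le hN one_pos zero_le_one hp y.2.1)
    (g := fun y => (D - 1) * Set.indicator (Set.Ioo 0 a) (fun y : ℝ => y ^ p) y -
      p * c ^ (p - 1) * Set.indicator (Set.Ioc a c) (fun y : ℝ => y - a) y)
    ((hint.const_mul _).sub (hint'.const_mul _)) (fun y => by
      have hy0 : (0 : ℝ) ≤ y := y.2.1
      have hyp : (0 : ℝ) ≤ (y : ℝ) ^ p := Real.rpow_nonneg hy0 p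
      rw [← hp]
      split_ifs with hyc
      · rw [mul_conjugate_truncatedPower hN ha hp hy0]
        rcases le_or_gt (y : ℝ) a with hya | hya
        · rw [min_eq_left hya, Set.indicator_of_notMem (s := Set.Ioc a c) (by simp [hya])]
          have : Set.indicator (Set.Ioo 0 a) (fun y : ℝ => y ^ p) y ≤ (y : ℝ) ^ p :=
            Set.indicator_le_self' (fun _ _ => hyp) _
          have h1 := mul_le_mul_of_nonneg_left this (by linarith : 0 ≤ D - 1)
          linarith
        · rw [min_eq_right hya.le, Set.indicator_of_mem (s := Set.Ioc a c) ⟨hya, hyc.le⟩,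
            Set.indicator_of_notMem (s := Set.Ioo 0 a) (by simp [hya.le])]
          have h1 := rpow_div_add_rpow_mul_sub_le hp1 ha.le hy0
          rw [← mul_le_mul_iff_right₀ hp0] at h1
          rw [mul_div_cancel₀ _ hp0.ne', mul_add, mul_div_cancel₀ _ hp0.ne'] at h1
          have h2 : (y : ℝ) ^ (p - 1) ≤ c ^ (p - 1) :=
            Real.rpow_le_rpow hy0 hyc.le (by linarith)
          have h3 := mul_le_mul_of_nonneg_right h2
            (mul_nonneg hp0.le (sub_nonneg.2 hya.le))
          have h4 := le_mul_of_one_le_left hap.le hD1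
          linarith
      · have hcy := not_lt.1 hyc
        rw [mul_conjugate_truncatedPower hN one_pos hp hy0, min_eq_left y.2.2, one_mul,
          Set.indicator_of_notMem (s := Set.Ioo 0 a) (by simp [hac.le.trans hcy])]
        have h1 : 0 ≤ Set.indicator (Set.Ioc a c) (fun y : ℝ => y - a) y :=
          Set.indicator_nonneg (fun z hz => by linarith [hz.1]) _
        have h2 : 0 ≤ p * c ^ (p - 1) := by positivity
        nlinarith [mul_nonneg h2 h1])
  rw [integral_sub (hint.const_mul _) (hint'.const_mul _), integral_const_mul, integral_const_mul,
    integral_indicator measurableSet_Ioo, integral_indicator measurableSet_Ioc] at key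
  linarith

end Optimality

/-! ### Passing to the limit: density and atom at 1. -/

section Limits

open Filter Topology

lemma measureReal_Ioc_eq_cdf_sub (μ : Measure ℝ) [IsProbabilityMeasure μ] {s c : ℝ} (h : s ≤ c) :
    μ.real (Set.Ioc s c) = ProbabilityTheory.cdf μ c - ProbabilityTheory.cdf μ s := by
  rw [ProbabilityTheory.cdf_eq_real, ProbabilityTheory.cdf_eq_real, ← Set.Iic_union_Ioc_eq_Iic h,
    measureReal_union (Set.Iic_disjoint_Ioc le_rfl) measurableSet_Ioc, add_sub_cancel_left]

/-- A layer cake bound for the first moment of a measure beyond a point where its distribution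
function is differentiable. -/
lemma setIntegral_sub_le_of_cdf_bound (μ : Measure ℝ) [IsProbabilityMeasure μ] {a c f ε : ℝ}
    (hac : a ≤ c)
    (hG : ∀ s ∈ Set.Icc a c,
      |ProbabilityTheory.cdf μ s - ProbabilityTheory.cdf μ a - f * (s - a)| ≤ ε * (s - a)) :
    ∫ s in Set.Ioc a c, (s - a) ∂μ ≤ (f / 2 + 2 * ε) * (c - a) ^ 2 := by
  have hint := integrableOn_sub μ a c
  have hh : 0 ≤ c - a := sub_nonneg.2 hac
  have hcont : Continuous fun t : ℝ => f * (c - a - t) + 2 * ε * (c - a) := by fun_prop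
  have hε : 0 ≤ ε * (c - a) := (abs_nonneg _).trans (hG c ⟨hac, le_rfl⟩)
  rw [Integrable.integral_eq_integral_meas_lt hint (by
    filter_upwards [ae_restrict_mem measurableSet_Ioc] with y hy
    exact sub_nonneg.2 hy.1.le)]
  calc ∫ t in Set.Ioi 0, (μ.restrict (Set.Ioc a c)).real {y | t < y - a}
      ≤ ∫ t in Set.Ioi 0, Set.indicator (Set.Ioc 0 (c - a))
          (fun t => f * (c - a - t) + 2 * ε * (c - a)) t := by
        refine integral_mono_of_nonneg (.of_forall fun t => measureReal_nonneg) ?_ ?_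
        · exact ((integrable_indicator_iff measurableSet_Ioc).2
            (hcont.integrableOn_Ioc)).integrableOn
        · filter_upwards [ae_restrict_mem measurableSet_Ioi] with t ht
          have ht0 : 0 < t := ht
          rw [measureReal_restrict_apply (measurableSet_lt measurable_const (by fun_prop))]
          by_cases htc : t ≤ c - a
          · rw [Set.indicator_of_mem (show t ∈ Set.Ioc 0 (c - a) from ⟨ht0, htc⟩)]
            have hset : {y | t < y - a} ∩ Set.Ioc a c = Set.Ioc (a + t) c := by
              ext y
              simp only [Set.mem_inter_iff, Set.mem_ofPred_eq, Set.mem_Ioc]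
              constructor
              · rintro ⟨h1, h2, h3⟩
                exact ⟨by linarith, h3⟩
              · rintro ⟨h1, h2⟩
                exact ⟨by linarith, by linarith, h2⟩
            rw [hset, measureReal_Ioc_eq_cdf_sub μ (by linarith)]
            -- The error 2ε(c - a) collects one ε(c - a) from each endpoint, c and a + t.
            have h1 := (abs_le.1 (hG c ⟨hac, le_rfl⟩)).2
            have h2 := (abs_le.1 (hG (a + t) ⟨by linarith, by linarith⟩)).1
            have hε0 : 0 ≤ ε := nonneg_of_mul_nonneg_left hε (by linarith)
            have h3 := mul_le_mul_of_nonneg_left htc hε0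
            rw [add_sub_cancel_left] at h2
            linarith
          · rw [Set.indicator_of_notMem (by simp [htc])]
            have hset : {y | t < y - a} ∩ Set.Ioc a c = ∅ := by
              ext y
              simp only [Set.mem_inter_iff, Set.mem_ofPred_eq, Set.mem_Ioc, Set.mem_empty_iff_false,
                iff_false]
              rintro ⟨h1, h2, h3⟩
              linarith
            rw [hset, measureReal_empty]
    _ = ∫ t in (0 : ℝ)..(c - a), (f * (c - a - t) + 2 * ε * (c - a)) := by
        rw [setIntegral_indicator measurableSet_Ioc, intervalIntegral.integral_of_le hh,
          Set.inter_eq_self_of_subset_right Set.Ioc_subset_Ioi_self]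
    _ = (f / 2 + 2 * ε) * (c - a) ^ 2 := by
        rw [intervalIntegral.integral_add (Continuous.intervalIntegrable (by fun_prop) _ _)
          (Continuous.intervalIntegrable (by fun_prop) _ _), intervalIntegral.integral_const_mul,
          intervalIntegral.integral_sub (Continuous.intervalIntegrable (by fun_prop) _ _)
          (Continuous.intervalIntegrable (by fun_prop) _ _)]
        simp only [intervalIntegral.integral_const, integral_id, smul_eq_mul]
        ring

variable {N : ℕ} {F : Measure unitInterval} [IsProbabilityMeasure F]

lemma density_ge_of_hasDerivAt (hN : 2 ≤ N)
    (hF : IsMaxmin (exclusiveMechanisms N) F (betaReserveAuction N)) {p : ℝ}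
    (hp : p = (N : ℝ) / ((N : ℝ) - 1)) {a f : ℝ} (ha : 0 < a) (ha1 : a < 1)
    (hf : HasDerivAt (fun y => ProbabilityTheory.cdf (onLine F) y) f a) :
    a ^ (-1 - p) * (p - 1) * ∫ s in Set.Ioo 0 a, s ^ p ∂(onLine F) ≤ f := by
  have hN' : (2 : ℝ) ≤ N := by exact_mod_cast hN
  have hN1 : (0 : ℝ) < N - 1 := by linarith
  have hp1 : 1 < p := by rw [hp, lt_div_iff₀ hN1]; linarith
  have hp2 : p ≤ 2 := by rw [hp, div_le_iff₀ hN1]; linarith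
  have hp0 : 0 < p := by linarith
  set Φ := ∫ s in Set.Ioo 0 a, s ^ p ∂(onLine F)
  have hΦ0 : 0 ≤ Φ := setIntegral_nonneg measurableSet_Ioo fun s hs => Real.rpow_nonneg hs.1.le _
  refine le_of_forall_pos_le_add fun δ hδ => ?_
  have hev : ∀ᶠ c in 𝓝[>] a,
      (p - 1) * c ^ (p - 2) / (a ^ p + p * a ^ (p - 1) * (c - a)) * Φ ≤
        c ^ (p - 1) * (f + δ) := by
    -- With ε = δ/4 the first-moment bound becomes (f + δ)/2 times (c - a)^2.
    have hε : 0 < δ / 4 := by linarith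
    have h1 := (hasDerivAt_iff_isLittleO.1 hf).def hε
    obtain ⟨r, hr, hball⟩ := Metric.eventually_nhds_iff.1 h1
    have h2 : ∀ᶠ c in 𝓝[>] a, c ∈ Set.Ioo a (min 1 (a + r)) :=
      Ioo_mem_nhdsGT (lt_min ha1 (by linarith))
    filter_upwards [h2] with c hc
    have hac : a < c := hc.1
    have hc1 : c < 1 := hc.2.trans_le (min_le_left _ _)
    have hcr : c < a + r := hc.2.trans_le (min_le_right _ _)
    have hc0 : 0 < c := ha.trans hac
    have hh : 0 < c - a := by linarith
    have hJ := setIntegral_sub_le_of_cdf_bound (onLine F) (f := f) (ε := δ / 4) hac.le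
      (fun s hs => by
        have h3 := hball (y := s) (by
          rw [Real.dist_eq, abs_of_nonneg (by linarith [hs.1])]; linarith [hs.2])
        rw [Real.norm_eq_abs, Real.norm_eq_abs, abs_of_nonneg (sub_nonneg.2 hs.1),
          smul_eq_mul] at h3
        rwa [mul_comm f])
    have hkey := taylor_mul_setIntegral_rpow_le hN hF hp ha hac hc1.le
    have hT := rpow_taylor_two_le hp1 hp2 ha hac.le
    have hE : 0 < a ^ p + p * a ^ (p - 1) * (c - a) := by positivity
    set E := a ^ p + p * a ^ (p - 1) * (c - a) with hEdef
    have hT' : p * (p - 1) / 2 * c ^ (p - 2) * (c - a) ^ 2 / E ≤ c ^ p / E - 1 := by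
      have : c ^ p / E - 1 = (c ^ p - E) / E := by field_simp
      rw [this]
      exact div_le_div_of_nonneg_right (by linarith) hE.le
    have h4 := (mul_le_mul_of_nonneg_right hT' hΦ0).trans (hkey.trans
      (mul_le_mul_of_nonneg_left hJ (by positivity)))
    have h5 : 0 < p * (c - a) ^ 2 / 2 := by positivity
    refine le_of_mul_le_mul_left ?_ h5
    calc _ = p * (p - 1) / 2 * c ^ (p - 2) * (c - a) ^ 2 / E * Φ := by ring
      _ ≤ _ := h4
      _ = _ := by ring
  have hl : Tendsto (fun c : ℝ => (p - 1) * c ^ (p - 2) / (a ^ p + p * a ^ (p - 1) * (c - a)) * Φ)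
      (𝓝[>] a) (𝓝 ((p - 1) * a ^ (p - 2) / (a ^ p + p * a ^ (p - 1) * (a - a)) * Φ)) := by
    refine ContinuousAt.tendsto (x := a) (f := fun c : ℝ => (p - 1) * c ^ (p - 2) /
      (a ^ p + p * a ^ (p - 1) * (c - a)) * Φ) ?_ |>.mono_left nhdsWithin_le_nhds
    refine ContinuousAt.mul (ContinuousAt.div ?_ (by fun_prop) ?_) continuousAt_const
    · exact continuousAt_const.mul (Real.continuousAt_rpow_const _ _ (.inl ha.ne'))
    · rw [sub_self, mul_zero, add_zero]
      positivity
  have hr : Tendsto (fun c : ℝ => c ^ (p - 1) * (f + δ)) (𝓝[>] a) (𝓝 (a ^ (p - 1) * (f + δ))) :=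
    ((Real.continuousAt_rpow_const _ _ (.inl ha.ne')).mul
      continuousAt_const).tendsto.mono_left nhdsWithin_le_nhds
  have hfin := le_of_tendsto_of_tendsto hl hr hev
  rw [sub_self, mul_zero, add_zero] at hfin
  have hpos : 0 < a ^ (p - 1) := by positivity
  refine le_of_mul_le_mul_left (le_trans (le_of_eq ?_) hfin) hpos
  have h6 : a ^ (p - 1) * a ^ (-1 - p) = a ^ (p - 2) / a ^ p := by
    rw [← Real.rpow_add ha, ← Real.rpow_sub ha]; ring_nf
  calc _ = (a ^ (p - 1) * a ^ (-1 - p)) * ((p - 1) * Φ) := by ring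
    _ = _ := by rw [h6]; ring

/-- As a increases to 1, the intervals (0, a) exhaust (0, 1) and (a, 1] shrinks to the atom. -/
lemma mass_ge_of_isMaxmin (hN : 2 ≤ N)
    (hF : IsMaxmin (exclusiveMechanisms N) F (betaReserveAuction N)) {p : ℝ}
    (hp : p = (N : ℝ) / ((N : ℝ) - 1)) :
    (p - 1) * ∫ s in Set.Ioo (0 : ℝ) 1, s ^ p ∂(onLine F) ≤ F.real {1} := by
  have hN' : (2 : ℝ) ≤ N := by exact_mod_cast hN
  have hN1 : (0 : ℝ) < N - 1 := by linarith
  have hp0 : 0 ≤ p := by rw [hp]; exact div_nonneg (by linarith) hN1.le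
  obtain ⟨u, hu, hu1, hlim⟩ := exists_seq_strictMono_tendsto' (zero_lt_one (α := ℝ))
  have hU : ⋃ n, Set.Ioo 0 (u n) = Set.Ioo (0 : ℝ) 1 := by
    ext x
    simp only [Set.mem_iUnion, Set.mem_Ioo, exists_and_left, and_congr_right_iff]
    refine fun _ => ⟨fun ⟨n, hn⟩ => hn.trans (hu1 n).2, fun hx => ?_⟩
    exact (hlim.eventually (lt_mem_nhds hx)).exists
  have hI : ⋂ n, Set.Ioc (u n) 1 = {(1 : ℝ)} := by
    ext x
    simp only [Set.mem_iInter, Set.mem_Ioc, Set.mem_singleton_iff]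
    refine ⟨fun h => le_antisymm (h 0).2 (le_of_tendsto' hlim fun n => (h n).1.le), ?_⟩
    rintro rfl n
    exact ⟨(hu1 n).2, le_rfl⟩
  have h1 := tendsto_setIntegral_of_monotone (μ := onLine F) (f := fun s : ℝ => s ^ p)
    (s := fun n => Set.Ioo 0 (u n)) (fun n => measurableSet_Ioo)
    (fun m n hmn => Set.Ioo_subset_Ioo_right (hu.monotone hmn)) (by
      rw [hU]
      exact (integrable_indicator_iff measurableSet_Ioo).1 (integrable_indicator_rpow hp0 le_rfl))
  have h2 := tendsto_measure_iInter_atTop (μ := onLine F) (s := fun n => Set.Ioc (u n) 1)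
    (fun n => measurableSet_Ioc.nullMeasurableSet)
    (fun m n hmn => Set.Ioc_subset_Ioc_left (hu.monotone hmn)) ⟨0, measure_ne_top _ _⟩
  rw [hU] at h1
  rw [hI] at h2
  have h3 := (ENNReal.tendsto_toReal (measure_ne_top _ _)).comp h2
  have h4 : (onLine F {1}).toReal = F.real {1} := by
    rw [onLine, Measure.map_apply measurable_subtype_coe (measurableSet_singleton _)]
    congr 2
    ext x
    simp
  rw [← h4]
  exact le_of_tendsto_of_tendsto' (h1.const_mul (p - 1)) h3 fun n =>
    mul_setIntegral_rpow_le_measureReal_Ioc hN hF hp (hu1 n).1 (hu1 n).2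

end Limits

end RobustAuction

theorem proposition4 (N : ℕ) (hN : 2 ≤ N) (F : Measure unitInterval) [IsProbabilityMeasure F]
    (hmaxmin : RobustAuction.IsMaxmin (RobustAuction.exclusiveMechanisms N) F
      (RobustAuction.betaReserveAuction N)) :
    RobustAuction.RegularityI N F := by
  have hN1 : (0 : ℝ) < N - 1 := by
    have : (2 : ℝ) ≤ N := by exact_mod_cast hN
    linarith
  have hp : (N : ℝ) / ((N : ℝ) - 1) - 1 = 1 / ((N : ℝ) - 1) := by field_simp; ring
  refine ⟨?_, ?_⟩
  · filter_upwards [ae_restrict_mem measurableSet_Ioo,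
      ae_restrict_of_ae (ProbabilityTheory.monotone_cdf
        (RobustAuction.onLine F)).ae_differentiableAt] with x hx hdiff
    have := RobustAuction.density_ge_of_hasDerivAt hN hmaxmin rfl hx.1 hx.2 hdiff.hasDerivAt
    rwa [hp, mul_one_div] at this
  · have := RobustAuction.mass_ge_of_isMaxmin hN hmaxmin rfl
    rwa [hp] at this
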